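/- Let $K$ be a field, let $G$ be a finite group, let $S\subseteq G$ be a subset that generates $G$, let $w:S\to\{1,2,3,\dots\}$ be a function (a weight function), and put $W=\sum_{s\in S}w(s)$. Let $\mathsf{Cay}(G,S,w)$ be the directed graph with vertex set $G$ that has, for every $g\in G$ and $s\in S$, exactly $w(s)$ edges from $g$ to $gs$ (and no other edges). For a directed graph $E=(E^0,E^1,s,r)$ with finitely many vertices and edges let $L(E)$ be its Leavitt path algebra over $K$, that is, the $K$-algebra presented by generators $v$ ($v\in E^0$) and $e,e^\ast$ ($e\in E^1$) and relations $vv'=\delta_{v,v'}v$ for $v,v'\in E^0$; $s(e)e=e=e\,r(e)$ and $r(e)e^\ast=e^\ast=e^\ast s(e)$ for $e\in E^1$; $e^\ast f=\delta_{e,f}\,r(e)$ for $e,f\in E^1$; and $v=\sum_{e\in s^{-1}(v)}ee^\ast$ for every $v\in E^0$ with $s^{-1}(v)\neq\emptyset$. It is unital, with identity $\sum_{v\in E^0}v$. Then the following are equivalent: (1) $L(\mathsf{Cay}(G,S,w))$ is purely infinite simple, that is, it is nonzero, it is not a division ring, and for each of its nonzero elements $x$ it has elements $b,c$ with $bxc=1$;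 (2) $W\ge 2$; (3) $L(\mathsf{Cay}(G,S,w))$ does not have Invariant Basis Number, that is, there are non-negative integers $m\neq n$ such that the free modules of ranks $m$ and $n$ over it are isomorphic. -/

import Mathlib

/-- A directed graph `(E⁰, E¹, s, r)` with vertex set `V` and edge set `E`; loops and
parallel edges are allowed. -/
structure DirGraph (V : Type*) (E : Type*) where
  /-- source of an edge -/
  s : E → V
  /-- range of an edge -/
  r : E → V

namespace DirGraph

/-- The weighted graph: each edge `e` is replaced by `w e` parallel copies
`e₁, …, e_{w e}`. -/
def weighted {V E : Type*} (Γ : DirGraph V E) (w : E → ℕ) :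
    DirGraph V (Σ e : E, Fin (w e)) where
  s e := Γ.s e.1
  r e := Γ.r e.1

/-- The Cayley graph `Cay(G, S)`: the vertices are the elements of `G`, and the edge
`(g, s)` runs from `g` to `g * s`. As `s` is determined by `g` and `g * s`, there is
exactly one edge from `g` to `h` if `h ∈ g S`, and none otherwise. -/
def cayley (G : Type*) [Group G] (S : Set G) : DirGraph G (G × S) where
  s e := e.1
  r e := e.1 * (e.2 : G)

/-- The weighted Cayley graph `Cay(G, S, w)`. -/
def weightedCayley (G : Type*) [Group G] (S : Set G) (w : S → ℕ) :
    DirGraph G (Σ e : G × S, Fin (w e.2)) :=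
  (cayley G S).weighted fun e => w e.2

/-- The generators `E⁰ ⊔ E¹ ⊔ (E¹)^*` of the Leavitt path algebra. -/
inductive LeavittGen (V : Type*) (E : Type*) where
  | vertex (v : V) : LeavittGen V E
  | edge (e : E) : LeavittGen V E
  | ghost (e : E) : LeavittGen V E

section Leavitt

variable (K : Type*) [Field K] {V E : Type*}

/-- A vertex, as an element of the free algebra. -/
def vtx (v : V) : FreeAlgebra K (LeavittGen V E) := FreeAlgebra.ι K (.vertex v)

/-- An edge `e`, as an element of the free algebra. -/
def edg (e : E) : FreeAlgebra K (LeavittGen V E) := FreeAlgebra.ι K (.edge e)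

/-- A ghost edge `e^*`, as an element of the free algebra. -/
def gst (e : E) : FreeAlgebra K (LeavittGen V E) := FreeAlgebra.ι K (.ghost e)

/-- The defining relations of the Leavitt path algebra: (V), (E), (CK1), (CK2). The relation
`unit` says that the sum of the vertices is the identity. In the algebra without a prescribed
identity presented by (V), (E), (CK1), (CK2), this sum is automatically a two-sided identity;
`unit` has to be listed because the free algebra used here comes with an identity of its own. -/
inductive LeavittRel [Fintype V] (Γ : DirGraph V E) :
    FreeAlgebra K (LeavittGen V E) → FreeAlgebra K (LeavittGen V E) → Prop
  | vertex_idem (v : V) : LeavittRel Γ (vtx K v * vtx K v) (vtx K v)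
  | vertex_orth (v v' : V) : v ≠ v' → LeavittRel Γ (vtx K v * vtx K v') 0
  | source_edge (e : E) : LeavittRel Γ (vtx K (Γ.s e) * edg K e) (edg K e)
  | edge_range (e : E) : LeavittRel Γ (edg K e * vtx K (Γ.r e)) (edg K e)
  | range_ghost (e : E) : LeavittRel Γ (vtx K (Γ.r e) * gst K e) (gst K e)
  | ghost_source (e : E) : LeavittRel Γ (gst K e * vtx K (Γ.s e)) (gst K e)
  | ck1_same (e : E) : LeavittRel Γ (gst K e * edg K e) (vtx K (Γ.r e))
  | ck1_diff (e f : E) : e ≠ f → LeavittRel Γ (gst K e * edg K f) 0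
  | ck2 (v : V) (hfin : {e : E | Γ.s e = v}.Finite) : {e : E | Γ.s e = v}.Nonempty →
      LeavittRel Γ (vtx K v) (∑ e ∈ hfin.toFinset, edg K e * gst K e)
  | unit : LeavittRel Γ (∑ v : V, vtx K v) 1

/-- The Leavitt path algebra `L_K(Γ)` of a directed graph with finitely many vertices. -/
abbrev LeavittPathAlgebra [Fintype V] (Γ : DirGraph V E) : Type _ :=
  RingQuot (LeavittRel K Γ)

end Leavitt

end DirGraph

/-- A unital ring `A` is purely infinite simple if it is nonzero, is not a division ring, and
for every `x ≠ 0` there are `b`, `c` with `b * x * c = 1`. -/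
structure IsPurelyInfiniteSimple (A : Type*) [Ring A] : Prop where
  nontrivial : Nontrivial A
  not_division : ¬ ∀ x : A, x ≠ 0 → IsUnit x
  exists_mul_mul_eq_one : ∀ x : A, x ≠ 0 → ∃ b c : A, b * x * c = 1

/-!
In the Leavitt path algebra `A` of `Cay(G, S, w)` let `x j` be the sum over `g` of the edges from
`g` with label `j` (a generator in `S` together with the number of a parallel copy), `y j` the sum
of the corresponding ghost edges, and `p g` the vertices. There are `W` labels. As right translation
permutes `G`, the `x j`, `y j` satisfy the relations of the Leavitt algebra of type `(1, W)`, while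
`p g * x j = x j * p (g * s)` for the generator `s` of `j`: this is a `GradedLeavittFamily`, and it
generates `A`.

* Right multiplication by the `x j` is an isomorphism `A ≅ A ^ W` of left modules, so invariant
  basis number fails for `2 ≤ W` (`GradedLeavittFamily.not_invariantBasisNumber`).
* Let `2 ≤ W` and let `z ≠ 0`. Multiplying `z` on the right by a long word in the `x j` and by some
  `p g` gives a nonzero combination of words ending at `g`
  (`GradedLeavittFamily.exists_mul_word_mem_longWordSpan`). If `α` is a shortest word that occurs
  and `τ = aᴺ b` with `a ≠ b` and `N` large, then compressing by the words `α τ` on the left and `τ`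
  on the right kills every other term and leaves a nonzero multiple of some `p h`
  (`GradedLeavittFamily.exists_mul_mul_eq_smul_p`). This needs no linear independence of words.
  As `S` generates the finite group `G` as a monoid, there are pairwise orthogonal words from `h` to
  every vertex, so `p h` generates `1` (`GradedLeavittFamily.exists_mul_p_mul_eq_one`).
* `A` acts on the functions on infinite paths (`DirGraph.pathRepresentation`), whence `A ≠ 0` for
  `1 ≤ W`. For `W = 1` there are only `|G|` infinite paths, so `A` maps to a finite-dimensional
  algebra; for `W = 0` the group is trivial and `A` maps to `K`. Such a homomorphism yields invariant
  basis number. If `A` were purely infinite simple, the homomorphism would embed `A` in a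
  Dedekind-finite ring, so that `b * z * c = 1` would make `z` a unit, and `A` a division ring.
-/

/-! ### Leavitt families graded by a group -/

/-- A family of elements `p g`, `x j`, `y j` of a ring: the `x j` and `y j` satisfy the relations
`y j * x k = δ_{jk}`, `∑ x j * y j = 1` of the Leavitt algebra of type `(1, |J|)`, and the `p g` are
orthogonal idempotents with sum `1` that `x j` shifts by the degree `d j`. -/
structure GradedLeavittFamily {A G J : Type*} [Ring A] [Group G] [Fintype G] [Fintype J]
    (d : J → G) (p : G → A) (x y : J → A) : Prop where
  p_mul_self (g : G) : p g * p g = p g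
  p_mul_of_ne {g h : G} : g ≠ h → p g * p h = 0
  sum_p : ∑ g, p g = 1
  p_mul_x (g : G) (j : J) : p g * x j = x j * p (g * d j)
  y_mul_p (g : G) (j : J) : y j * p g = p (g * d j) * y j
  y_mul_x_self (j : J) : y j * x j = 1
  y_mul_x_of_ne {j k : J} : j ≠ k → y j * x k = 0
  sum_x_mul_y : ∑ j, x j * y j = 1

namespace GradedLeavittFamily

section Words

variable {A J : Type*} [Ring A]

/-- The product `x j₁ * ⋯ * x jₙ` along the word `j₁ ⋯ jₙ`. -/
def word (x : J → A) (α : List J) : A := (α.map x).prod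

/-- The product `y jₙ * ⋯ * y j₁` along the word `j₁ ⋯ jₙ`, in reverse order: the left inverse of
`word x α`. -/
def revWord (y : J → A) : List J → A
  | [] => 1
  | j :: α => revWord y α * y j

@[simp] theorem word_nil (x : J → A) : word x [] = 1 := rfl

@[simp] theorem word_cons (x : J → A) (j : J) (α : List J) :
    word x (j :: α) = x j * word x α := by simp [word]

theorem word_append (x : J → A) (α β : List J) :
    word x (α ++ β) = word x α * word x β := by simp [word]

@[simp] theorem revWord_nil (y : J → A) : revWord y [] = 1 := rfl

@[simp] theorem revWord_cons (y : J → A) (j : J) (α : List J) :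
    revWord y (j :: α) = revWord y α * y j := rfl

end Words

variable {A G J : Type*} [Ring A] [Group G] [Fintype G] [Fintype J]
  {d : J → G} {p : G → A} {x y : J → A}

theorem p_mul_word (h : GradedLeavittFamily d p x y) (g : G) (α : List J) :
    p g * word x α = word x α * p (g * (α.map d).prod) := by
  induction α generalizing g with
  | nil => simp
  | cons j α ih =>
    rw [word_cons, ← mul_assoc, h.p_mul_x, mul_assoc, ih, List.map_cons, List.prod_cons,
      mul_assoc, mul_assoc]

theorem revWord_mul_word_self (h : GradedLeavittFamily d p x y) (α : List J) :
    revWord y α * word x α = 1 := by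
  induction α with
  | nil => simp
  | cons j α ih =>
    rw [revWord_cons, word_cons, mul_assoc, ← mul_assoc (y j), h.y_mul_x_self, one_mul, ih]

/-- Two words that differ at some common position have orthogonal products. -/
theorem revWord_mul_word_of_ne (h : GradedLeavittFamily d p x y) (α β : List J) (i : ℕ)
    (hα : i < α.length) (hβ : i < β.length) (hne : α[i] ≠ β[i]) :
    revWord y α * word x β = 0 := by
  induction α generalizing β i with
  | nil => simp at hα
  | cons j α ih =>
    cases β with
    | nil => simp at hβ
    | cons k β =>
      rw [revWord_cons, word_cons, mul_assoc, ← mul_assoc (y j)]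
      by_cases hjk : j = k
      · subst hjk
        cases i with
        | zero => simp at hne
        | succ i =>
          rw [h.y_mul_x_self, one_mul]
          exact ih β i (by simpa using hα) (by simpa using hβ) (by simpa using hne)
      · simp [h.y_mul_x_of_ne hjk]

/-- Right multiplication by all words of a given length is jointly injective. -/
theorem exists_mul_word_ne_zero (h : GradedLeavittFamily d p x y) {z : A} (hz : z ≠ 0) (n : ℕ) :
    ∃ α : List J, α.length = n ∧ z * word x α ≠ 0 := by
  induction n generalizing z with
  | zero => exact ⟨[], rfl, by simpa using hz⟩
  | succ n ih =>
    obtain ⟨j, hj⟩ : ∃ j, z * x j ≠ 0 := by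
      by_contra! H
      apply hz
      rw [← mul_one z, ← h.sum_x_mul_y, Finset.mul_sum]
      exact Finset.sum_eq_zero fun j _ => by rw [← mul_assoc, H, zero_mul]
    obtain ⟨α, hα, hne⟩ := ih hj
    exact ⟨j :: α, by simp [hα], by rwa [word_cons, ← mul_assoc]⟩

theorem exists_mul_p_ne_zero (h : GradedLeavittFamily d p x y) {z : A} (hz : z ≠ 0) :
    ∃ g, z * p g ≠ 0 := by
  by_contra! H
  apply hz
  rw [← mul_one z, ← h.sum_p, Finset.mul_sum]
  exact Finset.sum_eq_zero fun g _ => H g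

section Span

variable (K : Type*) [Field K] [Algebra K A]

/-- The linear span of the elements `word x α * p g` with `α` of length at least `n`. -/
def longWordSpan (p : G → A) (x : J → A) (n : ℕ) : Submodule K A :=
  Submodule.span K {a | ∃ (α : List J) (g : G), n ≤ α.length ∧ a = word x α * p g}

variable {K}

theorem word_mem_longWordSpan (h : GradedLeavittFamily d p x y) {n : ℕ} {α : List J}
    (hα : n ≤ α.length) : word x α ∈ longWordSpan K p x n := by
  rw [← mul_one (word x α), ← h.sum_p, Finset.mul_sum]
  exact Submodule.sum_mem _ fun g _ => Submodule.subset_span ⟨α, g, hα, rfl⟩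

theorem mul_p_mem_longWordSpan (h : GradedLeavittFamily d p x y) {n : ℕ} {a : A}
    (ha : a ∈ longWordSpan K p x n) (g : G) : a * p g ∈ longWordSpan K p x n := by
  induction ha using Submodule.span_induction with
  | mem a ha =>
    obtain ⟨α, g', hα, rfl⟩ := ha
    by_cases hg : g' = g
    · subst hg
      rw [mul_assoc, h.p_mul_self]
      exact Submodule.subset_span ⟨α, g', hα, rfl⟩
    · simp [mul_assoc, h.p_mul_of_ne hg]
  | zero => simp
  | add a b _ _ ha hb => rw [add_mul]; exact add_mem ha hb
  | smul c a _ ha => rw [smul_mul_assoc]; exact Submodule.smul_mem _ c ha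

/-- Right multiplication by long words removes every `y j` from an element of the algebra generated
by the family. The bound `n` is arbitrary so that the property passes to products: the first factor
then meets only words long enough for it. -/
theorem exists_mul_word_mem_longWordSpan (h : GradedLeavittFamily d p x y) {z : A}
    (hz : z ∈ Algebra.adjoin K (Set.range p ∪ Set.range x ∪ Set.range y)) (n : ℕ) :
    ∃ N, ∀ α : List J, N ≤ α.length → z * word x α ∈ longWordSpan K p x n := by
  induction hz using Algebra.adjoin_induction generalizing n with
  | mem z hz =>
    rcases hz with (⟨g, rfl⟩ | ⟨j, rfl⟩) | ⟨j, rfl⟩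
    · exact ⟨n, fun α hα => by
        rw [h.p_mul_word]
        exact Submodule.subset_span ⟨α, _, hα, rfl⟩⟩
    · exact ⟨n, fun α hα => by
        rw [← word_cons]
        exact h.word_mem_longWordSpan (by simp; omega)⟩
    · refine ⟨n + 1, fun α hα => ?_⟩
      cases α with
      | nil => simp at hα
      | cons k α =>
        rw [word_cons, ← mul_assoc]
        by_cases hjk : j = k
        · subst hjk
          rw [h.y_mul_x_self, one_mul]
          exact h.word_mem_longWordSpan (by simpa using hα)
        · simp [h.y_mul_x_of_ne hjk]
  | algebraMap c =>
    exact ⟨n, fun α hα => by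
      rw [← Algebra.smul_def]
      exact Submodule.smul_mem _ c (h.word_mem_longWordSpan hα)⟩
  | add a b _ _ ha hb =>
    obtain ⟨N, hN⟩ := ha n
    obtain ⟨M, hM⟩ := hb n
    refine ⟨max N M, fun α hα => ?_⟩
    rw [add_mul]
    exact add_mem (hN α (le_of_max_le_left hα)) (hM α (le_of_max_le_right hα))
  | mul a b _ _ ha hb =>
    obtain ⟨N, hN⟩ := ha n
    obtain ⟨M, hM⟩ := hb N
    refine ⟨M, fun α hα => ?_⟩
    rw [mul_assoc]
    have key : ∀ b' ∈ longWordSpan K p x N, a * b' ∈ longWordSpan K p x n := by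
      intro b' hb'
      induction hb' using Submodule.span_induction with
      | mem c hc =>
        obtain ⟨β, g, hβ, rfl⟩ := hc
        rw [← mul_assoc]
        exact h.mul_p_mem_longWordSpan (hN β hβ) g
      | zero => simp
      | add c c' _ _ hc hc' => rw [mul_add]; exact add_mem hc hc'
      | smul t c _ hc => rw [mul_smul_comm]; exact Submodule.smul_mem _ t hc
    exact key _ (hM α hα)

/-- An element `a * p g` with `a` a combination of words is a combination of words ending at `g`. -/
theorem exists_finsupp_of_mem_longWordSpan (h : GradedLeavittFamily d p x y) {a : A} {n : ℕ}
    (ha : a ∈ longWordSpan K p x n) (g : G) :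
    ∃ c : List J →₀ K, c.sum (fun α t => t • (word x α * p g)) = a * p g := by
  rw [← Finsupp.mem_span_range_iff_exists_finsupp]
  induction ha using Submodule.span_induction with
  | mem a ha =>
    obtain ⟨α, g', -, rfl⟩ := ha
    by_cases hg : g' = g
    · subst hg
      rw [mul_assoc, h.p_mul_self]
      exact Submodule.subset_span ⟨α, rfl⟩
    · simp [mul_assoc, h.p_mul_of_ne hg]
  | zero => simp
  | add a b _ _ ha hb => rw [add_mul]; exact add_mem ha hb
  | smul c a _ ha => rw [smul_mul_assoc]; exact Submodule.smul_mem _ c ha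

end Span

/-- If `α` is no longer than `β` and `β` is at most `N` long, then compressing `word x β` between
`α aᴺ b` and `aᴺ b` gives zero unless `β = α`. -/
theorem revWord_mul_word_append_replicate (h : GradedLeavittFamily d p x y) {a b : J} (hab : a ≠ b)
    {α β : List J} {N : ℕ} (hαβ : α.length ≤ β.length) (hβ : β.length ≤ N) (hne : α ≠ β) :
    revWord y (α ++ (List.replicate N a ++ [b])) *
      word x (β ++ (List.replicate N a ++ [b])) = 0 := by
  by_cases hpre : α <+: β
  · -- Write `β = α γ`; position `|α| + N` holds the letter `b` on the left and `a` on the right.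
    obtain ⟨γ, rfl⟩ := hpre
    have hγ : 0 < γ.length := by
      rw [List.length_pos_iff]; rintro rfl; simp at hne
    simp only [List.length_append] at hβ
    refine h.revWord_mul_word_of_ne _ _ (α.length + N) (by simp) (by simp; omega) ?_
    have h1 : ¬ (α.length + N < α.length + γ.length) := by omega
    have h2 : α.length + N - (α.length + γ.length) < N := by omega
    simp only [List.getElem_append, List.length_append, List.length_replicate,
      List.getElem_replicate, h1, h2]
    simpa using hab.symm
  · obtain ⟨i, hi, hdiff⟩ : ∃ (i : ℕ) (hi : i < α.length),
        α[i] ≠ β[i]'(hi.trans_le hαβ) := by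
      by_contra! H
      exact hpre (List.prefix_iff_getElem.mpr ⟨hαβ, fun i hi => H i hi⟩)
    refine h.revWord_mul_word_of_ne _ _ i (by simp; omega) (by simp; omega) ?_
    rwa [List.getElem_append_left hi, List.getElem_append_left (hi.trans_le hαβ)]

/-- The reduction step: every nonzero element generates a nonzero scalar multiple of some `p g`. -/
theorem exists_mul_mul_eq_smul_p {K : Type*} [Field K] [Algebra K A]
    (h : GradedLeavittFamily d p x y) {a b : J} (hab : a ≠ b) {z : A} (hz : z ≠ 0)
    (hmem : z ∈ Algebra.adjoin K (Set.range p ∪ Set.range x ∪ Set.range y)) :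
    ∃ (u v : A) (g : G) (t : K), t ≠ 0 ∧ u * z * v = t • p g := by
  obtain ⟨N, hN⟩ := h.exists_mul_word_mem_longWordSpan hmem 0
  obtain ⟨ω, hω, hne⟩ := h.exists_mul_word_ne_zero hz N
  obtain ⟨g, hg⟩ := h.exists_mul_p_ne_zero hne
  obtain ⟨c, hc⟩ := h.exists_finsupp_of_mem_longWordSpan (hN ω hω.ge) g
  have hcsupp : c.support.Nonempty := by
    rw [Finsupp.support_nonempty_iff]
    rintro rfl
    exact hg (by simpa using hc.symm)
  -- A shortest word `α` of the support, and a word `τ = aᴹ b` longer than every word of the support.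
  obtain ⟨α, hα, hmin⟩ := c.support.exists_min_image List.length hcsupp
  let M := c.support.sup List.length
  let τ := List.replicate M a ++ [b]
  refine ⟨revWord y (α ++ τ), word x ω * p g * word x τ, g * (τ.map d).prod, c α,
    Finsupp.mem_support_iff.mp hα, ?_⟩
  have hterm : ∀ β, revWord y (α ++ τ) * (word x β * p g) * word x τ =
      revWord y (α ++ τ) * word x (β ++ τ) * p (g * (τ.map d).prod) := fun β => by
    simp only [word_append, mul_assoc, h.p_mul_word]
  calc revWord y (α ++ τ) * z * (word x ω * p g * word x τ)
      = revWord y (α ++ τ) * (z * word x ω * p g) * word x τ := by simp only [mul_assoc]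
    _ = ∑ β ∈ c.support, c β • (revWord y (α ++ τ) * (word x β * p g) * word x τ) := by
        rw [← hc, Finsupp.sum, Finset.mul_sum, Finset.sum_mul]
        simp only [mul_smul_comm, smul_mul_assoc]
    _ = c α • p (g * (τ.map d).prod) := by
        rw [Finset.sum_eq_single_of_mem α hα, hterm, h.revWord_mul_word_self, one_mul]
        intro β hβ hβα
        rw [hterm, h.revWord_mul_word_append_replicate hab (hmin β hβ)
          (Finset.le_sup (f := List.length) hβ) hβα.symm, zero_mul, smul_zero]

/-- When the degrees generate the group, each `p g` is a full idempotent: the words `aⁱ b γ`, with a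
different exponent `i` for each endpoint in `G`, are pairwise orthogonal. -/
theorem exists_mul_p_mul_eq_one (h : GradedLeavittFamily d p x y)
    (hd : Subgroup.closure (Set.range d) = ⊤) {a b : J} (hab : a ≠ b) (g : G) :
    ∃ u v : A, u * p g * v = 1 := by
  classical
  -- In a finite group, a generating set also generates as a monoid.
  have hword : ∀ k : G, ∃ γ : List J, (γ.map d).prod = k := fun k => by
    have hk : k ∈ Submonoid.closure (Set.range d) := by
      rw [← Subgroup.closure_toSubmonoid_of_finite, hd]; trivial
    induction hk using Submonoid.closure_induction with
    | mem k hk => obtain ⟨j, rfl⟩ := hk; exact ⟨[j], by simp⟩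
    | one => exact ⟨[], rfl⟩
    | mul k l _ _ hk hl =>
      obtain ⟨γ, rfl⟩ := hk
      obtain ⟨δ, rfl⟩ := hl
      exact ⟨γ ++ δ, by simp⟩
  choose γ hγ using hword
  let n : G → ℕ := fun k => Fintype.equivFin G k
  have hn : Function.Injective n := Fin.val_injective.comp (Fintype.equivFin G).injective
  let σ : G → List J := fun k => List.replicate (n k) a ++ [b]
  let ω : G → List J := fun k => σ k ++ γ ((g * ((σ k).map d).prod)⁻¹ * k)
  have hω : ∀ k, g * ((ω k).map d).prod = k := fun k => by
    simp only [ω, List.map_append, List.prod_append, hγ]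
    group
  have horth : ∀ k l, k ≠ l → revWord y (ω k) * word x (ω l) = 0 := by
    intro k l hkl
    rcases lt_or_gt_of_ne (hn.ne hkl) with hlt | hlt
    · refine h.revWord_mul_word_of_ne _ _ (n k) (by simp [ω, σ]) (by simp [ω, σ]; omega) ?_
      simp [ω, σ, hlt, hab.symm]
    · refine h.revWord_mul_word_of_ne _ _ (n l) (by simp [ω, σ]; omega) (by simp [ω, σ]) ?_
      simp [ω, σ, hlt, hab]
  refine ⟨∑ k, revWord y (ω k), ∑ l, word x (ω l), ?_⟩
  rw [Finset.sum_mul, Finset.sum_mul, ← h.sum_p]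
  refine Finset.sum_congr rfl fun k _ => ?_
  rw [Finset.mul_sum, Finset.sum_eq_single_of_mem k (Finset.mem_univ k)]
  · rw [mul_assoc, h.p_mul_word, ← mul_assoc, h.revWord_mul_word_self, one_mul, hω]
  · intro l _ hlk
    rw [mul_assoc, h.p_mul_word, ← mul_assoc, horth k l hlk.symm, zero_mul]

theorem isPurelyInfiniteSimple {K : Type*} [Field K] [Algebra K A] [Nontrivial A] [Nontrivial J]
    (h : GradedLeavittFamily d p x y) (hd : Subgroup.closure (Set.range d) = ⊤)
    (hgen : Algebra.adjoin K (Set.range p ∪ Set.range x ∪ Set.range y) = ⊤) :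
    IsPurelyInfiniteSimple A := by
  obtain ⟨a, b, hab⟩ := exists_pair_ne J
  refine ⟨‹_›, fun H => ?_, fun z hz => ?_⟩
  · have hx : x b ≠ 0 := fun h0 => one_ne_zero (α := A) (by rw [← h.y_mul_x_self b, h0, mul_zero])
    have hy : y a = 0 := (H _ hx).mul_left_eq_zero.mp (h.y_mul_x_of_ne hab)
    exact one_ne_zero (α := A) (by rw [← h.y_mul_x_self a, hy, zero_mul])
  · obtain ⟨u, v, g, t, ht, huv⟩ :=
      h.exists_mul_mul_eq_smul_p (K := K) hab hz (hgen ▸ Algebra.mem_top)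
    obtain ⟨u', v', hu⟩ := h.exists_mul_p_mul_eq_one hd hab g
    refine ⟨t⁻¹ • (u' * u), v * v', ?_⟩
    calc t⁻¹ • (u' * u) * z * (v * v') = t⁻¹ • (u' * (u * z * v) * v') := by
          simp only [smul_mul_assoc, mul_assoc]
      _ = 1 := by
          rw [huv, mul_smul_comm, smul_mul_assoc, smul_smul, inv_mul_cancel₀ ht, one_smul, hu]

/-- Right multiplication by the `x j` identifies the left module `A` with `A ^ |J|`. -/
theorem not_invariantBasisNumber (h : GradedLeavittFamily d p x y) [Nontrivial J] :
    ¬ InvariantBasisNumber A := by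
  intro _
  classical
  let e : A ≃ₗ[A] (J → A) :=
    { toFun := fun a j => a * x j
      invFun := fun f => ∑ j, f j * y j
      map_add' := fun a b => by ext; simp [add_mul]
      map_smul' := fun a b => by ext; simp [mul_assoc]
      left_inv := fun a => by simp [mul_assoc, ← Finset.mul_sum, h.sum_x_mul_y]
      right_inv := fun f => by
        ext k
        simp only [Finset.sum_mul, mul_assoc]
        rw [Finset.sum_eq_single_of_mem k (Finset.mem_univ k), h.y_mul_x_self, mul_one]
        intro j _ hjk
        rw [h.y_mul_x_of_ne hjk, mul_zero] }
  have hcard := card_eq_of_linearEquiv A ((LinearEquiv.funUnique Unit A A).trans e)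
  have := Fintype.one_lt_card (α := J)
  simp at hcard
  omega

end GradedLeavittFamily

/-! ### Obstructions from homomorphisms to finite rings -/

/-- A purely infinite simple ring has no homomorphism to a nonzero Dedekind-finite ring: such a
homomorphism would be injective and would force every nonzero element to be a unit. -/
theorem IsPurelyInfiniteSimple.not_isDedekindFinite {A B : Type*} [Ring A] [Ring B] [Nontrivial B]
    [IsDedekindFiniteMonoid B] (hA : IsPurelyInfiniteSimple A) (φ : A →+* B) : False := by
  have hinj : Function.Injective φ := by
    rw [injective_iff_map_eq_zero]
    intro z hz
    by_contra hne
    obtain ⟨b, c, hbc⟩ := hA.exists_mul_mul_eq_one z hne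
    simpa [hz] using congrArg φ hbc
  have : IsDedekindFiniteMonoid A := .of_injective φ hinj
  refine hA.not_division fun z hz => ?_
  obtain ⟨b, c, hbc⟩ := hA.exists_mul_mul_eq_one z hz
  have h1 : z * (c * b) = 1 := by rw [← mul_assoc]; exact mul_eq_one_symm (by rwa [← mul_assoc])
  exact ⟨⟨z, c * b, h1, mul_eq_one_symm h1⟩, rfl⟩

/-- Invariant basis number is inherited along a ring homomorphism from its target. -/
theorem RingHom.invariantBasisNumber {A B : Type*} [Ring A] [Ring B] (φ : A →+* B)
    [InvariantBasisNumber B] : InvariantBasisNumber A := by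
  rw [invariantBasisNumber_iff_matrix]
  intro n m f g hfg hgf
  refine (invariantBasisNumber_iff_matrix (R := B)).mp ‹_› n m (f.map φ) (g.map φ) ?_ ?_
  · rw [← Matrix.map_mul, hfg, Matrix.map_one _ (map_zero φ) (map_one φ)]
  · rw [← Matrix.map_mul, hgf, Matrix.map_one _ (map_zero φ) (map_one φ)]

/-! ### The relations of the Leavitt path algebra -/

namespace DirGraph

section Generators

variable (K : Type*) [Field K] {V E : Type*} [Fintype V] (Γ : DirGraph V E)

/-- A vertex, as an element of the Leavitt path algebra. -/
def lvtx (v : V) : LeavittPathAlgebra K Γ := RingQuot.mkAlgHom K (LeavittRel K Γ) (vtx K v)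

/-- An edge, as an element of the Leavitt path algebra. -/
def ledg (e : E) : LeavittPathAlgebra K Γ := RingQuot.mkAlgHom K (LeavittRel K Γ) (edg K e)

/-- A ghost edge, as an element of the Leavitt path algebra. -/
def lgst (e : E) : LeavittPathAlgebra K Γ := RingQuot.mkAlgHom K (LeavittRel K Γ) (gst K e)

theorem lvtx_mul_self (v : V) : lvtx K Γ v * lvtx K Γ v = lvtx K Γ v := by
  rw [lvtx, ← map_mul]; exact RingQuot.mkAlgHom_rel K (.vertex_idem v)

theorem lvtx_mul_of_ne {v v' : V} (h : v ≠ v') : lvtx K Γ v * lvtx K Γ v' = 0 := by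
  rw [lvtx, lvtx, ← map_mul, ← map_zero (RingQuot.mkAlgHom K (LeavittRel K Γ))]
  exact RingQuot.mkAlgHom_rel K (.vertex_orth v v' h)

theorem lvtx_mul_ledg (e : E) : lvtx K Γ (Γ.s e) * ledg K Γ e = ledg K Γ e := by
  rw [lvtx, ledg, ← map_mul]; exact RingQuot.mkAlgHom_rel K (.source_edge e)

theorem ledg_mul_lvtx (e : E) : ledg K Γ e * lvtx K Γ (Γ.r e) = ledg K Γ e := by
  rw [lvtx, ledg, ← map_mul]; exact RingQuot.mkAlgHom_rel K (.edge_range e)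

theorem lvtx_mul_lgst (e : E) : lvtx K Γ (Γ.r e) * lgst K Γ e = lgst K Γ e := by
  rw [lvtx, lgst, ← map_mul]; exact RingQuot.mkAlgHom_rel K (.range_ghost e)

theorem lgst_mul_lvtx (e : E) : lgst K Γ e * lvtx K Γ (Γ.s e) = lgst K Γ e := by
  rw [lvtx, lgst, ← map_mul]; exact RingQuot.mkAlgHom_rel K (.ghost_source e)

theorem lgst_mul_ledg_self (e : E) : lgst K Γ e * ledg K Γ e = lvtx K Γ (Γ.r e) := by
  rw [lvtx, lgst, ledg, ← map_mul]; exact RingQuot.mkAlgHom_rel K (.ck1_same e)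

theorem lgst_mul_ledg_of_ne {e f : E} (h : e ≠ f) : lgst K Γ e * ledg K Γ f = 0 := by
  rw [lgst, ledg, ← map_mul, ← map_zero (RingQuot.mkAlgHom K (LeavittRel K Γ))]
  exact RingQuot.mkAlgHom_rel K (.ck1_diff e f h)

theorem lvtx_eq_sum (v : V) (hfin : {e : E | Γ.s e = v}.Finite)
    (hne : {e : E | Γ.s e = v}.Nonempty) :
    lvtx K Γ v = ∑ e ∈ hfin.toFinset, ledg K Γ e * lgst K Γ e := by
  simp only [lvtx, ledg, lgst, ← map_mul, ← map_sum]
  exact RingQuot.mkAlgHom_rel K (.ck2 v hfin hne)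

theorem sum_lvtx : ∑ v, lvtx K Γ v = 1 := by
  simp only [lvtx, ← map_sum]
  rw [← map_one (RingQuot.mkAlgHom K (LeavittRel K Γ))]
  exact RingQuot.mkAlgHom_rel K .unit

theorem lvtx_mul_ledg_of_ne {v : V} {e : E} (h : v ≠ Γ.s e) : lvtx K Γ v * ledg K Γ e = 0 := by
  rw [← lvtx_mul_ledg, ← mul_assoc, lvtx_mul_of_ne K Γ h, zero_mul]

theorem ledg_mul_lvtx_of_ne {v : V} {e : E} (h : Γ.r e ≠ v) : ledg K Γ e * lvtx K Γ v = 0 := by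
  rw [← ledg_mul_lvtx, mul_assoc, lvtx_mul_of_ne K Γ h, mul_zero]

theorem lvtx_mul_lgst_of_ne {v : V} {e : E} (h : v ≠ Γ.r e) : lvtx K Γ v * lgst K Γ e = 0 := by
  rw [← lvtx_mul_lgst, ← mul_assoc, lvtx_mul_of_ne K Γ h, zero_mul]

theorem lgst_mul_lvtx_of_ne {v : V} {e : E} (h : Γ.s e ≠ v) : lgst K Γ e * lvtx K Γ v = 0 := by
  rw [← lgst_mul_lvtx, mul_assoc, lvtx_mul_of_ne K Γ h, mul_zero]

theorem ledg_mul_lgst_of_ne {e f : E} (h : Γ.r e ≠ Γ.r f) : ledg K Γ e * lgst K Γ f = 0 := by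
  rw [← ledg_mul_lvtx, mul_assoc, lvtx_mul_lgst_of_ne K Γ h, mul_zero]

theorem adjoin_eq_top :
    Algebra.adjoin K (Set.range (lvtx K Γ) ∪ Set.range (ledg K Γ) ∪ Set.range (lgst K Γ)) = ⊤ := by
  rw [eq_top_iff]
  have hsurj := (AlgHom.range_eq_top _).mpr (RingQuot.mkAlgHom_surjective K (LeavittRel K Γ))
  rw [← hsurj, ← Algebra.map_top, ← FreeAlgebra.adjoin_range_ι, AlgHom.map_adjoin]
  apply Algebra.adjoin_mono
  rintro _ ⟨_, ⟨i, rfl⟩, rfl⟩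
  cases i with
  | vertex v => exact Or.inl (Or.inl ⟨v, rfl⟩)
  | edge e => exact Or.inl (Or.inr ⟨e, rfl⟩)
  | ghost e => exact Or.inr ⟨e, rfl⟩

end Generators

/-! ### The Leavitt family of a weighted Cayley graph -/

section Labels

variable {G : Type*} {S : Set G}

/-- The labels of the edges of the weighted Cayley graph: a generator together with the number of
one of its parallel copies. -/
abbrev CayleyLabel (w : S → ℕ) : Type _ := Σ s : S, Fin (w s)

/-- The edge with source `g` and label `j`. -/
def labelEdge (w : S → ℕ) (g : G) (j : CayleyLabel w) : Σ e : G × S, Fin (w e.2) := ⟨(g, j.1), j.2⟩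

variable {w : S → ℕ}

theorem labelEdge_injective2 : Function.Injective2 (labelEdge w (G := G)) := by
  rintro g g' ⟨s, i⟩ ⟨s', i'⟩ h
  simp only [labelEdge, Sigma.mk.injEq, Prod.mk.injEq] at h
  obtain ⟨⟨rfl, rfl⟩, hi⟩ := h
  exact ⟨rfl, by rw [eq_of_heq hi]⟩

theorem exists_eq_labelEdge (e : Σ e : G × S, Fin (w e.2)) : ∃ g j, e = labelEdge w g j :=
  ⟨e.1.1, ⟨e.1.2, e.2⟩, rfl⟩

end Labels

section Cayley

variable (K : Type*) [Field K] {G : Type*} [Group G] {S : Set G} {w : S → ℕ}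

@[simp] theorem weightedCayley_s_labelEdge (g : G) (j : CayleyLabel w) :
    (weightedCayley G S w).s (labelEdge w g j) = g := rfl

@[simp] theorem weightedCayley_r_labelEdge (g : G) (j : CayleyLabel w) :
    (weightedCayley G S w).r (labelEdge w g j) = g * j.1 := rfl

theorem sum_edges_of_source [Fintype S] {M : Type*} [AddCommMonoid M] (g : G)
    (hfin : {e | (weightedCayley G S w).s e = g}.Finite)
    (f : (Σ e : G × S, Fin (w e.2)) → M) :
    ∑ e ∈ hfin.toFinset, f e = ∑ j : CayleyLabel w, f (labelEdge w g j) := by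
  symm
  refine Finset.sum_bij (fun j _ => labelEdge w g j) (by simp)
    (fun j _ k _ hjk => (labelEdge_injective2 hjk).2) (fun e he => ?_) (fun _ _ => rfl)
  obtain ⟨g', j, rfl⟩ := exists_eq_labelEdge e
  obtain rfl : g' = g := by simpa using he
  exact ⟨j, Finset.mem_univ j, rfl⟩

variable [Fintype G]

variable (w) in
/-- The sum of all edges labelled `j`. -/
def edgeSum (j : CayleyLabel w) : LeavittPathAlgebra K (weightedCayley G S w) :=
  ∑ g, ledg K (weightedCayley G S w) (labelEdge w g j)

variable (w) in
/-- The sum of all ghost edges labelled `j`. -/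
def ghostSum (j : CayleyLabel w) : LeavittPathAlgebra K (weightedCayley G S w) :=
  ∑ g, lgst K (weightedCayley G S w) (labelEdge w g j)

theorem lvtx_mul_edgeSum (g : G) (j : CayleyLabel w) :
    lvtx K (weightedCayley G S w) g * edgeSum K w j =
      ledg K (weightedCayley G S w) (labelEdge w g j) := by
  rw [edgeSum, Finset.mul_sum, Finset.sum_eq_single_of_mem g (Finset.mem_univ g)]
  · exact lvtx_mul_ledg K (weightedCayley G S w) (labelEdge w g j)
  · exact fun g' _ hg => lvtx_mul_ledg_of_ne K _ hg.symm

theorem edgeSum_mul_lvtx (g : G) (j : CayleyLabel w) :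
    edgeSum K w j * lvtx K (weightedCayley G S w) (g * j.1) =
      ledg K (weightedCayley G S w) (labelEdge w g j) := by
  rw [edgeSum, Finset.sum_mul, Finset.sum_eq_single_of_mem g (Finset.mem_univ g)]
  · exact ledg_mul_lvtx K (weightedCayley G S w) (labelEdge w g j)
  · exact fun g' _ hg => ledg_mul_lvtx_of_ne K _ fun h => hg (mul_right_cancel h)

theorem ghostSum_mul_lvtx (g : G) (j : CayleyLabel w) :
    ghostSum K w j * lvtx K (weightedCayley G S w) g =
      lgst K (weightedCayley G S w) (labelEdge w g j) := by
  rw [ghostSum, Finset.sum_mul, Finset.sum_eq_single_of_mem g (Finset.mem_univ g)]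
  · exact lgst_mul_lvtx K (weightedCayley G S w) (labelEdge w g j)
  · exact fun g' _ hg => lgst_mul_lvtx_of_ne K _ hg

theorem lvtx_mul_ghostSum (g : G) (j : CayleyLabel w) :
    lvtx K (weightedCayley G S w) (g * j.1) * ghostSum K w j =
      lgst K (weightedCayley G S w) (labelEdge w g j) := by
  rw [ghostSum, Finset.mul_sum, Finset.sum_eq_single_of_mem g (Finset.mem_univ g)]
  · exact lvtx_mul_lgst K (weightedCayley G S w) (labelEdge w g j)
  · exact fun g' _ hg => lvtx_mul_lgst_of_ne K _ fun h => hg (mul_right_cancel h).symm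

variable (w) in
/-- In the Leavitt path algebra of a Cayley graph, the sums of equally labelled edges form a
Leavitt family graded by the group. -/
theorem gradedLeavittFamily [Fintype S] [Nonempty (CayleyLabel w)] :
    GradedLeavittFamily (fun j : CayleyLabel w => (j.1 : G)) (lvtx K (weightedCayley G S w))
      (edgeSum K w) (ghostSum K w) where
  p_mul_self := lvtx_mul_self K _
  p_mul_of_ne := lvtx_mul_of_ne K _
  sum_p := sum_lvtx K _
  p_mul_x g j := by rw [lvtx_mul_edgeSum, edgeSum_mul_lvtx]
  y_mul_p g j := by rw [ghostSum_mul_lvtx, lvtx_mul_ghostSum]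
  y_mul_x_self j := by
    -- The edges labelled `j` end at each vertex exactly once, by right translation.
    rw [ghostSum, edgeSum, Finset.sum_mul, ← sum_lvtx K (weightedCayley G S w),
      ← Equiv.sum_comp (Equiv.mulRight (j.1 : G)) (lvtx K (weightedCayley G S w))]
    refine Finset.sum_congr rfl fun g _ => ?_
    rw [Finset.mul_sum, Finset.sum_eq_single_of_mem g (Finset.mem_univ g)]
    · exact lgst_mul_ledg_self K (weightedCayley G S w) (labelEdge w g j)
    · exact fun g' _ hg => lgst_mul_ledg_of_ne K _ fun h => hg (labelEdge_injective2 h).1.symm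
  y_mul_x_of_ne hjk := by
    rw [ghostSum, edgeSum, Finset.sum_mul]
    refine Finset.sum_eq_zero fun g _ => ?_
    rw [Finset.mul_sum]
    exact Finset.sum_eq_zero fun g' _ =>
      lgst_mul_ledg_of_ne K _ fun h => hjk (labelEdge_injective2 h).2
  sum_x_mul_y := by
    have hdiag : ∀ j : CayleyLabel w, edgeSum K w j * ghostSum K w j =
        ∑ g, ledg K (weightedCayley G S w) (labelEdge w g j) *
          lgst K (weightedCayley G S w) (labelEdge w g j) := fun j => by
      rw [edgeSum, ghostSum, Finset.sum_mul]
      refine Finset.sum_congr rfl fun g _ => ?_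
      rw [Finset.mul_sum, Finset.sum_eq_single_of_mem g (Finset.mem_univ g)]
      exact fun g' _ hg => ledg_mul_lgst_of_ne K _ fun h => hg (mul_right_cancel h).symm
    simp_rw [hdiag]
    rw [Finset.sum_comm, ← sum_lvtx K (weightedCayley G S w)]
    refine Finset.sum_congr rfl fun g _ => ?_
    obtain ⟨j⟩ := ‹Nonempty (CayleyLabel w)›
    rw [lvtx_eq_sum K (weightedCayley G S w) g (Set.toFinite _) ⟨labelEdge w g j, rfl⟩,
      sum_edges_of_source]

variable (w) in
theorem adjoin_edgeSum_eq_top :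
    Algebra.adjoin K (Set.range (lvtx K (weightedCayley G S w)) ∪ Set.range (edgeSum K w) ∪
      Set.range (ghostSum K w)) = ⊤ := by
  rw [eq_top_iff, ← adjoin_eq_top K (weightedCayley G S w)]
  apply Algebra.adjoin_le
  rintro _ ((⟨g, rfl⟩ | ⟨e, rfl⟩) | ⟨e, rfl⟩)
  · exact Algebra.subset_adjoin (Or.inl (Or.inl ⟨g, rfl⟩))
  · obtain ⟨g, j, rfl⟩ := exists_eq_labelEdge e
    rw [← lvtx_mul_edgeSum]
    exact mul_mem (Algebra.subset_adjoin (Or.inl (Or.inl ⟨g, rfl⟩)))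
      (Algebra.subset_adjoin (Or.inl (Or.inr ⟨j, rfl⟩)))
  · obtain ⟨g, j, rfl⟩ := exists_eq_labelEdge e
    rw [← ghostSum_mul_lvtx]
    exact mul_mem (Algebra.subset_adjoin (Or.inr ⟨j, rfl⟩))
      (Algebra.subset_adjoin (Or.inl (Or.inl ⟨g, rfl⟩)))

end Cayley

/-! ### The representation on infinite paths -/

section Representation

variable (K : Type*) [Field K] {G : Type*} [Group G] {S : Set G} (w : S → ℕ)

open Classical in
/-- The action of the generators of the Leavitt path algebra on functions of pairs `(g, ξ)`, where
the infinite word `ξ` of labels stands for the infinite path from `g` with those labels. A vertex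
restricts a function to the paths that start there. An edge `e` composes it with the map that
deletes the first step of a path beginning with `e`, a ghost edge `e^*` with the map that prepends
`e` to a path from the range of `e`; both give zero on all other paths. -/
noncomputable def pathAction :
    LeavittGen G (Σ e : G × S, Fin (w e.2)) →
      Module.End K (G × (ℕ → CayleyLabel w) → K)
  | .vertex v =>
    { toFun := fun f q => if q.1 = v then f q else 0
      map_add' := fun f f' => by ext q; by_cases hq : q.1 = v <;> simp [hq]
      map_smul' := fun t f => by ext q; by_cases hq : q.1 = v <;> simp [hq] }
  | .edge e =>
    { toFun := fun f q => if labelEdge w q.1 (q.2 0) = e then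
        f (q.1 * (q.2 0).1, fun n => q.2 (n + 1)) else 0
      map_add' := fun f f' => by
        ext q; by_cases hq : labelEdge w q.1 (q.2 0) = e <;> simp [hq]
      map_smul' := fun t f => by
        ext q; by_cases hq : labelEdge w q.1 (q.2 0) = e <;> simp [hq] }
  | .ghost e =>
    { toFun := fun f q => if q.1 = (weightedCayley G S w).r e then
        f (e.1.1, fun n => Nat.casesOn n ⟨e.1.2, e.2⟩ q.2) else 0
      map_add' := fun f f' => by
        ext q; by_cases hq : q.1 = (weightedCayley G S w).r e <;> simp [hq]
      map_smul' := fun t f => by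
        ext q; by_cases hq : q.1 = (weightedCayley G S w).r e <;> simp [hq] }

open Classical in
theorem pathAction_vertex (v : G) (f : G × (ℕ → CayleyLabel w) → K)
    (g : G) (ξ : ℕ → CayleyLabel w) :
    pathAction K w (.vertex v) f (g, ξ) = if g = v then f (g, ξ) else 0 := rfl

open Classical in
theorem pathAction_edge (h : G) (j : CayleyLabel w) (f : G × (ℕ → CayleyLabel w) → K)
    (g : G) (ξ : ℕ → CayleyLabel w) :
    pathAction K w (.edge (labelEdge w h j)) f (g, ξ) =
      if g = h ∧ ξ 0 = j then f (g * (ξ 0).1, fun n => ξ (n + 1)) else 0 := by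
  have : labelEdge w g (ξ 0) = labelEdge w h j ↔ g = h ∧ ξ 0 = j := labelEdge_injective2.eq_iff
  simp only [← this]
  rfl

open Classical in
theorem pathAction_ghost (h : G) (j : CayleyLabel w) (f : G × (ℕ → CayleyLabel w) → K)
    (g : G) (ξ : ℕ → CayleyLabel w) :
    pathAction K w (.ghost (labelEdge w h j)) f (g, ξ) =
      if g = h * j.1 then f (h, fun n => Nat.casesOn n j ξ) else 0 := rfl

/-- The representation of the Leavitt path algebra on functions on the space of infinite paths. -/
noncomputable def pathRepresentation [Fintype G] [Fintype S] :
    LeavittPathAlgebra K (weightedCayley G S w) →ₐ[K]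
      Module.End K (G × (ℕ → CayleyLabel w) → K) :=
  RingQuot.liftAlgHom K ⟨FreeAlgebra.lift K (pathAction K w), by
    classical
    intro a b hab
    induction hab with
    | vertex_idem v =>
      ext f ⟨g, ξ⟩
      simp only [vtx, map_mul, FreeAlgebra.lift_ι_apply, Module.End.mul_apply, pathAction_vertex]
      aesop
    | vertex_orth v v' hne =>
      ext f ⟨g, ξ⟩
      simp only [vtx, map_mul, FreeAlgebra.lift_ι_apply, Module.End.mul_apply, pathAction_vertex]
      aesop
    | source_edge e =>
      obtain ⟨h, j, rfl⟩ := exists_eq_labelEdge e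
      ext f ⟨g, ξ⟩
      simp only [map_mul, FreeAlgebra.lift_ι_apply, Module.End.mul_apply,
        vtx, edg, pathAction_vertex, pathAction_edge]
      aesop
    | edge_range e =>
      obtain ⟨h, j, rfl⟩ := exists_eq_labelEdge e
      ext f ⟨g, ξ⟩
      simp only [map_mul, FreeAlgebra.lift_ι_apply, Module.End.mul_apply,
        vtx, edg, pathAction_vertex, pathAction_edge]
      aesop
    | range_ghost e =>
      obtain ⟨h, j, rfl⟩ := exists_eq_labelEdge e
      ext f ⟨g, ξ⟩
      simp only [vtx, gst, map_mul, FreeAlgebra.lift_ι_apply, Module.End.mul_apply,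
        pathAction_vertex, pathAction_ghost]
      aesop
    | ghost_source e =>
      obtain ⟨h, j, rfl⟩ := exists_eq_labelEdge e
      ext f ⟨g, ξ⟩
      simp only [vtx, gst, map_mul, FreeAlgebra.lift_ι_apply, Module.End.mul_apply,
        pathAction_vertex, pathAction_ghost, weightedCayley_s_labelEdge, if_true]
    | ck1_same e =>
      obtain ⟨h, j, rfl⟩ := exists_eq_labelEdge e
      ext f ⟨g, ξ⟩
      simp only [map_mul, FreeAlgebra.lift_ι_apply, Module.End.mul_apply,
        vtx, gst, edg, pathAction_vertex, pathAction_ghost, pathAction_edge]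
      aesop
    | ck1_diff e e' hne =>
      obtain ⟨h, j, rfl⟩ := exists_eq_labelEdge e
      obtain ⟨h', j', rfl⟩ := exists_eq_labelEdge e'
      ext f ⟨g, ξ⟩
      simp only [map_mul, FreeAlgebra.lift_ι_apply, Module.End.mul_apply, map_zero,
        LinearMap.zero_apply, Pi.zero_apply, gst, edg, pathAction_ghost, pathAction_edge]
      aesop
    | ck2 v hfin hne =>
      rw [sum_edges_of_source]
      ext f ⟨g, ξ⟩
      simp only [vtx, gst, edg, map_sum, map_mul, FreeAlgebra.lift_ι_apply, LinearMap.sum_apply,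
        Finset.sum_apply, Module.End.mul_apply, pathAction_vertex, pathAction_edge,
        pathAction_ghost]
      -- Only the edge that begins the path `(g, ξ)` contributes: it is deleted and put back.
      rw [Finset.sum_eq_single_of_mem (ξ 0) (Finset.mem_univ _)]
      · by_cases hg : g = v
        · subst hg
          simp only [true_and, if_true]
          have hξ : (fun n => Nat.casesOn n (ξ 0) fun n => ξ (n + 1)) = ξ := by
            funext n
            cases n <;> rfl
          exact congrArg (fun ζ => f (g, ζ)) hξ.symm
        · simp [hg]
      · intro j _ hj
        simp [hj.symm]
    | unit =>
      ext f ⟨g, ξ⟩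
      simp [vtx, pathAction_vertex]⟩

end Representation

/-! ### Total weight at most one -/

section SmallWeight

variable (K : Type*) [Field K] {G : Type*} [Group G] [Fintype G] {S : Set G} (w : S → ℕ)

/-- Without edges and with a single vertex, the Leavitt path algebra maps to the field: the vertex
goes to `1`. -/
noncomputable def toFieldOfIsEmpty [Subsingleton G] [IsEmpty (CayleyLabel w)] :
    LeavittPathAlgebra K (weightedCayley G S w) →ₐ[K] K :=
  RingQuot.liftAlgHom K ⟨FreeAlgebra.lift K fun _ => 1, by
    have hE : (Σ e : G × S, Fin (w e.2)) → False := fun e =>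
      isEmptyElim (⟨e.1.2, e.2⟩ : CayleyLabel w)
    intro a b hab
    induction hab with
    | vertex_idem v => simp [vtx]
    | vertex_orth v v' hne => exact (hne (Subsingleton.elim _ _)).elim
    | source_edge e => exact (hE e).elim
    | edge_range e => exact (hE e).elim
    | range_ghost e => exact (hE e).elim
    | ghost_source e => exact (hE e).elim
    | ck1_same e => exact (hE e).elim
    | ck1_diff e => exact (hE e).elim
    | ck2 v hfin hne => exact (hE hne.some).elim
    | unit =>
      have : Unique G := uniqueOfSubsingleton 1
      simp [vtx]⟩

/-- For total weight at most `1`, the algebra maps to a nonzero Noetherian ring: to `K` without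
edges, and otherwise to the endomorphisms of the finite-dimensional space of functions on the `|G|`
infinite paths. -/
theorem not_isPurelyInfiniteSimple_and_invariantBasisNumber [Fintype S]
    (hS : Subgroup.closure S = ⊤) (hw : ∀ s, 0 < w s) (hW : ∑ s, w s ≤ 1) :
    ¬ IsPurelyInfiniteSimple (LeavittPathAlgebra K (weightedCayley G S w)) ∧
      InvariantBasisNumber (LeavittPathAlgebra K (weightedCayley G S w)) := by
  have hsub : Subsingleton (CayleyLabel w) := by
    rw [← Fintype.card_le_one_iff_subsingleton]; simpa using hW
  rcases isEmpty_or_nonempty (CayleyLabel w) with hJ | hJ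
  · have hSe : S = ∅ := by
      rw [Set.eq_empty_iff_forall_notMem]
      exact fun s hs => hJ.elim ⟨⟨s, hs⟩, ⟨0, hw _⟩⟩
    have : Subsingleton G := by
      rw [hSe, Subgroup.closure_empty] at hS
      exact Subgroup.subsingleton_iff.mp (subsingleton_of_bot_eq_top hS)
    let φ := (toFieldOfIsEmpty K w).toRingHom
    exact ⟨fun h => h.not_isDedekindFinite φ, φ.invariantBasisNumber⟩
  · have : Unique (CayleyLabel w) := @Unique.mk' _ ⟨hJ.some⟩ hsub
    let φ := (pathRepresentation K w).toRingHom
    have : IsNoetherianRing (Module.End K (G × (ℕ → CayleyLabel w) → K)) :=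
      IsNoetherianRing.of_finite K _
    exact ⟨fun h => h.not_isDedekindFinite φ, φ.invariantBasisNumber⟩

end SmallWeight

end DirGraph

/-! ### The equivalence -/

theorem mainTheorem2 (K : Type*) [Field K] (G : Type*) [Group G] [Fintype G]
    (S : Set G) [Fintype S] (hS : Subgroup.closure S = ⊤)
    (w : S → ℕ) (hw : ∀ s, 0 < w s) :
    List.TFAE [
      IsPurelyInfiniteSimple
        (DirGraph.LeavittPathAlgebra K (DirGraph.weightedCayley G S w)),
      2 ≤ ∑ s : S, w s,
      ¬ InvariantBasisNumber
        (DirGraph.LeavittPathAlgebra K (DirGraph.weightedCayley G S w))] := by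
  have hlow : ¬ 2 ≤ ∑ s, w s → _ := fun h =>
    DirGraph.not_isPurelyInfiniteSimple_and_invariantBasisNumber K w hS hw (by omega)
  have hhigh : 2 ≤ ∑ s, w s → _ ∧ _ := fun hW => by
    have : Nontrivial (DirGraph.CayleyLabel w) := by
      rw [← Fintype.one_lt_card_iff_nontrivial]; simpa [Nat.succ_le_iff] using hW
    -- The target is nonzero because there is a label, hence an infinite path.
    have := (DirGraph.pathRepresentation K w).toRingHom.domain_nontrivial
    have hfam := DirGraph.gradedLeavittFamily K w
    have hrange : Set.range (fun j : DirGraph.CayleyLabel w => (j.1 : G)) = S := by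
      ext g
      exact ⟨fun ⟨j, hj⟩ => hj ▸ j.1.2, fun hg => ⟨⟨⟨g, hg⟩, ⟨0, hw _⟩⟩, rfl⟩⟩
    exact ⟨hfam.isPurelyInfiniteSimple (by rw [hrange, hS]) (DirGraph.adjoin_edgeSum_eq_top K w),
      hfam.not_invariantBasisNumber⟩
  tfae_have 1 → 2 := fun h => by_contra fun hW => (hlow hW).1 h
  tfae_have 3 → 2 := fun h => by_contra fun hW => h (hlow hW).2
  tfae_have 2 → 1 := fun hW => (hhigh hW).1
  tfae_have 2 → 3 := fun hW => (hhigh hW).2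
  tfae_finish
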